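/- Fix $0<p<1/2$. Let $E\subset\partial\mathbb D$ be a closed subset of the unit circle of zero length, and let $\{J\}$ be its complementary arcs, i.e. the connected components of $\partial\mathbb D\setminus E$ (if $E=\varnothing$, the family of arcs is taken to be empty). For an arc $J$ let $|J|\in(0,1]$ be its length, normalized so that $|\partial\mathbb D|=1$, and let $z_J=(1-|J|/2)\,e^{i\theta_J}$, where $e^{i\theta_J}$ is the midpoint of $J$. Let $\mu$ be a finite positive Borel measure on $\partial\mathbb D$ supported on $E$, let $$S_\mu(z)=\exp\Bigl(-\int_{\partial\mathbb D}\frac{\zeta+z}{\zeta-z}\,d\mu(\zeta)\Bigr),\qquad u(z)=\int_{\partial\mathbb D}\frac{1-|z|^2}{|\zeta-z|^2}\,d\mu(\zeta),\qquad |z|<1,$$ be the associated singular inner function and the Poisson integral of $\mu$. Then $S_\mu'$ belongs to the Hardy space $H^p$, i.e. $\sup_{0\le r<1}\frac1{2\pi}\int_0^{2\pi}|S_\mu'(re^{i\theta})|^p\,d\theta<\infty$, if and only if $$\sum_J u(z_J)^p\,|J|^{1-p}<\infty.$$ -/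

import Mathlib

open Real MeasureTheory Set

noncomputable section

/-- The singular inner function `S_μ(z) = exp (-∫ (ζ + z) / (ζ - z) dμ(ζ))` of a measure `μ`
carried by the unit circle. It is only of interest for `‖z‖ < 1`. -/
def singularInner (μ : Measure ℂ) (z : ℂ) : ℂ :=
  Complex.exp (-∫ ζ, (ζ + z) / (ζ - z) ∂μ)

/-- The Poisson integral `P_μ(z) = ∫ (1 - |z|²) / |ζ - z|² dμ(ζ)` of a measure `μ`
carried by the unit circle. -/
def poissonIntegral (μ : Measure ℂ) (z : ℂ) : ℝ :=
  ∫ ζ, (1 - ‖z‖ ^ 2) / ‖ζ - z‖ ^ 2 ∂μ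

/-- The Hardy space `H^p` of the unit disk, for `0 < p < ∞`: `f` is holomorphic in the open unit
disk and the means `(2π)⁻¹ ∫_0^{2π} |f(r e^{iθ})|^p dθ`, `0 ≤ r < 1`, are bounded. -/
def MemHardy (p : ℝ) (f : ℂ → ℂ) : Prop :=
  DifferentiableOn ℂ f (Metric.ball 0 1) ∧
    ∃ C : ℝ, ∀ r : ℝ, 0 ≤ r → r < 1 → circleAverage (fun z => ‖f z‖ ^ p) 0 r ≤ C

/-- Arc length on the unit circle, normalized to have total mass one, as a measure on `ℂ`. -/
def circleLength : Measure ℂ :=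
  ENNReal.ofReal (2 * π)⁻¹ •
    Measure.map (fun θ : ℝ => Complex.exp (θ * Complex.I)) (volume.restrict (Ioc 0 (2 * π)))

/-- The complementary arcs of a nonempty closed subset `E` of the unit circle, that is, the
connected components of the complement of `E` in the circle. The arc
`{e^{iθ} : a < θ < b}` is recorded as the pair `(a, b)`, with `a` the angle in `[0, 2π)` of its
initial endpoint, so that every complementary arc is listed exactly once. Since
`e^{i(a + 2π)} = e^{ia} ∈ E`, one has `b ≤ a + 2π`. (There are none for empty `E`.) -/
def complementaryArcs (E : Set ℂ) : Set (ℝ × ℝ) :=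
  {J | 0 ≤ J.1 ∧ J.1 < 2 * π ∧ J.1 < J.2 ∧
    Complex.exp (J.1 * Complex.I) ∈ E ∧ Complex.exp (J.2 * Complex.I) ∈ E ∧
    ∀ θ ∈ Ioo J.1 J.2, Complex.exp (θ * Complex.I) ∉ E}

/-- The normalized length `|J| = (b - a) / 2π ∈ (0, 1]` of the arc `J = {e^{iθ} : a < θ < b}`. -/
def arcLength (J : ℝ × ℝ) : ℝ := (J.2 - J.1) / (2 * π)

/-- The point `z_J = (1 - |J| / 2) e^{iθ_J}`, where `e^{iθ_J}` is the midpoint of the arc `J`. -/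
def arcPoint (J : ℝ × ℝ) : ℂ :=
  ((1 - arcLength J / 2 : ℝ) : ℂ) * Complex.exp (((J.1 + J.2) / 2 : ℝ) * Complex.I)

end

/-!
Write `S` for the singular inner function of `μ` and `P(w) = ∫ |ζ - w|⁻² dμ(ζ)`. Differentiating
the Herglotz integral gives `S'(z) = -S(z) ∫ 2ζ / (ζ - z)² dμ(ζ)`, hence `|S'(z)| ≤ 2 P(z)` in the
disk. If `ξ` is a point of the circle off `E`, then `P(rξ) ≤ 4 P(ξ)` because
`|ζ - ξ| ≤ 2 |ζ - rξ|`, and `|S'(rξ)| → 2 P(ξ)` as `r → 1`, because `ζ ξ / (ζ - ξ)²` is negative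
on the circle and `|S(rξ)| → 1`. As `E` is null, domination in one direction and Fatou's lemma in
the other show that `S' ∈ H^p` if and only if `∫ P^p` over the circle is finite
(`memHardy_deriv_singularInner_iff`).

The complementary arcs fill the circle up to a null set, so this integral is the sum of those over
the arcs (`tsum_lintegral_arcs_le`, `lintegral_boundaryPower_le`). On an arc `J` the potential is
compared with its value at `z_J`, whose distances to the points of `E` are at least `|J| / 2`. If
`d` is the distance from `ξ ∈ J` to the endpoints of `J`, the triangle inequality gives
`c P(z_J) ≤ P(ξ) ≤ C (|J| / d)² P(z_J)` with absolute constants. Since `2p < 1`, the function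
`(|J| / d)^{2p}` has integral comparable to `|J|` over `J`, so `∫_J P^p` is comparable to
`|J| P(z_J)^p` (`ofReal_arcTerm_le`, `lintegral_arc_boundaryPower_le`). Finally
`u(z_J) = (1 - |z_J|²) P(z_J)` is comparable to `|J| P(z_J)`, and `|J| P(z_J)^p` becomes
`u(z_J)^p |J|^{1 - p}`.
-/

open Filter Topology

/-! ### The inverse square potential -/

/-- The potential `w ↦ ∫ |ζ - w|⁻² dμ(ζ)`. It is meaningful at points `w` off a closed
set carrying `μ`, where the integrand is bounded almost everywhere; the remaining points of the
circle form a null set here, so the convention that the integral is `0` when it diverges plays no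
role. -/
noncomputable def inverseSquarePotential (μ : Measure ℂ) (w : ℂ) : ℝ :=
  ∫ ζ, 1 / ‖ζ - w‖ ^ 2 ∂μ

theorem ae_mem_of_measure_compl {μ : Measure ℂ} {E : Set ℂ} (hμ : μ Eᶜ = 0) :
    ∀ᵐ ζ ∂μ, ζ ∈ E := by
  rw [ae_iff]; exact hμ

theorem exists_pos_le_norm_sub {E : Set ℂ} (hE : IsClosed E) {w : ℂ} (hw : w ∉ E) :
    ∃ δ > 0, ∀ ζ ∈ E, δ ≤ ‖ζ - w‖ := by
  obtain ⟨δ, hδ, h⟩ := Metric.isOpen_iff.1 hE.isOpen_compl w hw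
  refine ⟨δ, hδ, fun ζ hζ => ?_⟩
  by_contra! hlt
  exact h (by rwa [Metric.mem_ball, dist_eq_norm]) hζ

theorem notMem_of_norm_lt_one {E : Set ℂ} (hEc : E ⊆ Metric.sphere 0 1) {z : ℂ}
    (hz : ‖z‖ < 1) : z ∉ E := by
  intro h
  have := hEc h
  rw [mem_sphere_zero_iff_norm] at this
  linarith

theorem inverseSquarePotential_nonneg (μ : Measure ℂ) (w : ℂ) :
    0 ≤ inverseSquarePotential μ w :=
  integral_nonneg fun ζ => by positivity

theorem poissonIntegral_eq_mul (μ : Measure ℂ) (z : ℂ) :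
    poissonIntegral μ z = (1 - ‖z‖ ^ 2) * inverseSquarePotential μ z := by
  rw [poissonIntegral, inverseSquarePotential, ← integral_const_mul]
  exact integral_congr_ae (.of_forall fun ζ => by simp [div_eq_mul_inv])

section

variable {μ : Measure ℂ} [IsFiniteMeasure μ] {E : Set ℂ}

theorem integrable_one_div_norm_sub_sq (hE : IsClosed E) (hμ : μ Eᶜ = 0) {w : ℂ} (hw : w ∉ E) :
    Integrable (fun ζ => 1 / ‖ζ - w‖ ^ 2) μ := by
  obtain ⟨δ, hδ, h⟩ := exists_pos_le_norm_sub hE hw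
  refine Integrable.of_bound (C := 1 / δ ^ 2) ?_ ?_
  · exact Measurable.aestronglyMeasurable (by fun_prop)
  · filter_upwards [ae_mem_of_measure_compl hμ] with ζ hζ
    rw [Real.norm_of_nonneg (by positivity)]
    have := h ζ hζ
    gcongr

/-- Potentials are comparable at points whose distances to the support are comparable. -/
theorem inverseSquarePotential_le_of_norm_sub_le (hE : IsClosed E) (hμ : μ Eᶜ = 0) {w w' : ℂ}
    (hw : w ∉ E) {c : ℝ} (h : ∀ ζ ∈ E, ‖ζ - w‖ ≤ c * ‖ζ - w'‖) :
    inverseSquarePotential μ w' ≤ c ^ 2 * inverseSquarePotential μ w := by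
  obtain ⟨δ, hδ, hδ'⟩ := exists_pos_le_norm_sub hE hw
  rw [inverseSquarePotential, inverseSquarePotential, ← integral_const_mul]
  refine integral_mono_of_nonneg (.of_forall fun ζ => by positivity)
    ((integrable_one_div_norm_sub_sq hE hμ hw).const_mul _) ?_
  filter_upwards [ae_mem_of_measure_compl hμ] with ζ hζ
  have h1 := h ζ hζ
  have h2 := hδ' ζ hζ
  have h3 : 0 < c * ‖ζ - w'‖ := by linarith
  have h4 : 0 < ‖ζ - w'‖ := by
    rcases (norm_nonneg (ζ - w')).eq_or_lt with h0 | h0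
    · rw [← h0] at h3; simp at h3
    · exact h0
  have h5 : 0 < ‖ζ - w‖ := by linarith
  rw [mul_one_div, div_le_div_iff₀ (by positivity) (by positivity), ← mul_pow, one_mul]
  gcongr

/-! ### The derivative of the singular inner function -/

theorem integrable_herglotz (hE : IsClosed E) (hEc : E ⊆ Metric.sphere 0 1) (hμ : μ Eᶜ = 0)
    {z : ℂ} (hz : z ∉ E) : Integrable (fun ζ => (ζ + z) / (ζ - z)) μ := by
  obtain ⟨δ, hδ, h⟩ := exists_pos_le_norm_sub hE hz
  refine Integrable.of_bound (C := (1 + ‖z‖) / δ) ?_ ?_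
  · exact Measurable.aestronglyMeasurable (by fun_prop)
  · filter_upwards [ae_mem_of_measure_compl hμ] with ζ hζ
    have h1 : ‖ζ‖ = 1 := by simpa using hEc hζ
    have := h ζ hζ
    have h2 := norm_add_le ζ z
    rw [norm_div]
    gcongr
    linarith

theorem hasDerivAt_singularInner (hE : IsClosed E) (hEc : E ⊆ Metric.sphere 0 1)
    (hμ : μ Eᶜ = 0) {z : ℂ} (hz : z ∉ E) :
    HasDerivAt (singularInner μ)
      (singularInner μ z * -∫ ζ, 2 * ζ / (ζ - z) ^ 2 ∂μ) z := by
  obtain ⟨δ, hδ, h⟩ := exists_pos_le_norm_sub hE hz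
  have hfar : ∀ ζ ∈ E, ∀ x ∈ Metric.ball z (δ / 2), δ / 2 ≤ ‖ζ - x‖ := by
    intro ζ hζ x hx
    rw [Metric.mem_ball, dist_eq_norm] at hx
    have h1 := h ζ hζ
    have h2 : ‖ζ - z‖ ≤ ‖ζ - x‖ + ‖x - z‖ := norm_sub_le_norm_sub_add_norm_sub _ _ _
    linarith
  have key : HasDerivAt (fun x => ∫ ζ, (ζ + x) / (ζ - x) ∂μ)
      (∫ ζ, 2 * ζ / (ζ - z) ^ 2 ∂μ) z := by
    refine (hasDerivAt_integral_of_dominated_loc_of_deriv_le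
      (F := fun x ζ => (ζ + x) / (ζ - x)) (F' := fun x ζ => 2 * ζ / (ζ - x) ^ 2)
      (bound := fun _ => 2 / (δ / 2) ^ 2)
      (Metric.ball_mem_nhds z (half_pos hδ)) ?_ ?_ ?_ ?_ ?_ ?_).2
    · exact .of_forall fun x => Measurable.aestronglyMeasurable (by fun_prop)
    · exact integrable_herglotz hE hEc hμ hz
    · exact Measurable.aestronglyMeasurable (by fun_prop)
    · filter_upwards [ae_mem_of_measure_compl hμ] with ζ hζ x hx
      have h1 : ‖ζ‖ = 1 := by simpa using hEc hζ
      have h2 := hfar ζ hζ x hx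
      rw [norm_div, norm_mul, norm_pow, h1, mul_one, Complex.norm_ofNat]
      gcongr
    · exact integrable_const _
    · filter_upwards [ae_mem_of_measure_compl hμ] with ζ hζ x hx
      have h2 := hfar ζ hζ x hx
      have h3 : ζ - x ≠ 0 := norm_pos_iff.1 (by linarith)
      refine (((hasDerivAt_id x).const_add ζ).div
        ((hasDerivAt_id x).const_sub ζ) h3).congr_deriv ?_
      simp only [id]
      ring
  exact key.neg.cexp

theorem deriv_singularInner (hE : IsClosed E) (hEc : E ⊆ Metric.sphere 0 1)
    (hμ : μ Eᶜ = 0) {z : ℂ} (hz : z ∉ E) :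
    deriv (singularInner μ) z = singularInner μ z * -∫ ζ, 2 * ζ / (ζ - z) ^ 2 ∂μ :=
  (hasDerivAt_singularInner hE hEc hμ hz).deriv

theorem differentiableOn_deriv_singularInner (hE : IsClosed E) (hEc : E ⊆ Metric.sphere 0 1)
    (hμ : μ Eᶜ = 0) :
    DifferentiableOn ℂ (deriv (singularInner μ)) (Metric.ball 0 1) := by
  refine DifferentiableOn.deriv (fun z hz => ?_) Metric.isOpen_ball
  exact (hasDerivAt_singularInner hE hEc hμ
    (notMem_of_norm_lt_one hEc (by simpa using hz))).differentiableAt.differentiableWithinAt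

theorem re_herglotz {ζ z : ℂ} (hζ : ‖ζ‖ = 1) :
    ((ζ + z) / (ζ - z)).re = (1 - ‖z‖ ^ 2) / ‖ζ - z‖ ^ 2 := by
  have h1 : ζ.re * ζ.re + ζ.im * ζ.im = 1 := by
    rw [← Complex.normSq_apply, Complex.normSq_eq_norm_sq, hζ, one_pow]
  rw [Complex.div_re, ← Complex.normSq_eq_norm_sq, ← Complex.normSq_eq_norm_sq, ← add_div,
    Complex.normSq_apply z, ← h1]
  simp only [Complex.add_re, Complex.sub_re, Complex.add_im, Complex.sub_im]
  ring

theorem norm_singularInner (hE : IsClosed E) (hEc : E ⊆ Metric.sphere 0 1)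
    (hμ : μ Eᶜ = 0) {z : ℂ} (hz : z ∉ E) :
    ‖singularInner μ z‖ = Real.exp (-poissonIntegral μ z) := by
  rw [singularInner, Complex.norm_exp, Complex.neg_re, poissonIntegral]
  congr 2
  have := integral_re (𝕜 := ℂ) (integrable_herglotz hE hEc hμ hz)
  simp only [RCLike.re_to_complex] at this
  rw [← this]
  refine integral_congr_ae ?_
  filter_upwards [ae_mem_of_measure_compl hμ] with ζ hζ
  exact re_herglotz (by simpa using hEc hζ)

theorem norm_deriv_singularInner_le (hE : IsClosed E) (hEc : E ⊆ Metric.sphere 0 1)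
    (hμ : μ Eᶜ = 0) {z : ℂ} (hz : ‖z‖ < 1) :
    ‖deriv (singularInner μ) z‖ ≤ 2 * inverseSquarePotential μ z := by
  have hzE := notMem_of_norm_lt_one hEc hz
  have h1 : ‖singularInner μ z‖ ≤ 1 := by
    rw [norm_singularInner hE hEc hμ hzE, Real.exp_le_one_iff, neg_nonpos, poissonIntegral_eq_mul]
    refine mul_nonneg ?_ (inverseSquarePotential_nonneg _ _)
    nlinarith [norm_nonneg z]
  have h2 : ‖∫ ζ, 2 * ζ / (ζ - z) ^ 2 ∂μ‖ ≤ 2 * inverseSquarePotential μ z := by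
    rw [inverseSquarePotential, ← integral_const_mul]
    refine norm_integral_le_of_norm_le
      ((integrable_one_div_norm_sub_sq hE hμ hzE).const_mul 2) ?_
    filter_upwards [ae_mem_of_measure_compl hμ] with ζ hζ
    have h1 : ‖ζ‖ = 1 := by simpa using hEc hζ
    rw [norm_div, norm_mul, norm_pow, h1, Complex.norm_ofNat, mul_one, mul_one_div]
  rw [deriv_singularInner hE hEc hμ hzE, norm_mul, norm_neg]
  calc _ ≤ 1 * (2 * inverseSquarePotential μ z) := by gcongr
    _ = _ := one_mul _

theorem norm_sub_le_two_mul_norm_sub_smul {ζ w : ℂ} (hζ : ‖ζ‖ = 1) (hw : ‖w‖ = 1) {r : ℝ}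
    (h0 : 0 ≤ r) (h1 : r < 1) : ‖ζ - w‖ ≤ 2 * ‖ζ - r * w‖ := by
  have h2 : ‖ζ - w‖ ≤ ‖ζ - r * w‖ + ‖r * w - w‖ := norm_sub_le_norm_sub_add_norm_sub _ _ _
  have h3 : ‖(r : ℂ) * w - w‖ = 1 - r := by
    rw [← sub_one_mul, norm_mul, hw, mul_one, ← Complex.ofReal_one, ← Complex.ofReal_sub,
      Complex.norm_real, Real.norm_eq_abs, abs_sub_comm, abs_of_pos (by linarith)]
  have h4 : ‖ζ‖ - ‖r * w‖ ≤ ‖ζ - r * w‖ := norm_sub_norm_le _ _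
  rw [norm_mul, hζ, hw, Complex.norm_real, Real.norm_of_nonneg h0] at h4
  linarith

/-- Along the radius ending at a boundary point off `E`, the potential is dominated by its value at
the boundary point. -/
theorem inverseSquarePotential_radial_le (hE : IsClosed E) (hEc : E ⊆ Metric.sphere 0 1)
    (hμ : μ Eᶜ = 0) {w : ℂ} (hw : ‖w‖ = 1) (hwE : w ∉ E) {r : ℝ} (h0 : 0 ≤ r) (h1 : r < 1) :
    inverseSquarePotential μ (r * w) ≤ 4 * inverseSquarePotential μ w := by
  have := inverseSquarePotential_le_of_norm_sub_le (μ := μ) hE hμ hwE (w' := r * w) (c := 2)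
    fun ζ hζ => norm_sub_le_two_mul_norm_sub_smul (by simpa using hEc hζ) hw h0 h1
  linarith

/-- On the circle `ζ w / (ζ - w)²` is real: it equals `-|ζ - w|⁻²`. -/
theorem two_mul_div_sub_sq {ζ w : ℂ} (hζ : ‖ζ‖ = 1) (hw : ‖w‖ = 1) :
    2 * ζ / (ζ - w) ^ 2 = -2 * w⁻¹ * ((1 / ‖ζ - w‖ ^ 2 : ℝ) : ℂ) := by
  have hζ0 : ζ ≠ 0 := norm_pos_iff.1 (by linarith)
  have hw0 : w ≠ 0 := norm_pos_iff.1 (by linarith)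
  rcases eq_or_ne ζ w with rfl | hne
  · simp
  have h1 : ((‖ζ - w‖ ^ 2 : ℝ) : ℂ) = (ζ - w) * (ζ⁻¹ - w⁻¹) := by
    rw [Complex.inv_eq_conj hζ, Complex.inv_eq_conj hw, ← map_sub, Complex.mul_conj,
      Complex.normSq_eq_norm_sq]
  have h2 : ζ - w ≠ 0 := sub_ne_zero.2 hne
  have h3 : w - ζ ≠ 0 := sub_ne_zero.2 hne.symm
  rw [Complex.ofReal_div, h1, Complex.ofReal_one, inv_sub_inv hζ0 hw0]
  field_simp
  ring

/-- Off `E` the radial limit of `|S'|` is `2 ∫ |ζ - w|⁻² dμ(ζ)`: the Poisson integral tends to `0`,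
so `|S| → 1`, and on the circle all values of `ζ w / (ζ - w)²` have the same argument, so nothing
cancels in the integral. -/
theorem tendsto_norm_deriv_singularInner (hE : IsClosed E) (hEc : E ⊆ Metric.sphere 0 1)
    (hμ : μ Eᶜ = 0) {w : ℂ} (hw : ‖w‖ = 1) (hwE : w ∉ E) :
    Tendsto (fun r : ℝ => ‖deriv (singularInner μ) (r * w)‖) (𝓝[<] 1)
      (𝓝 (2 * inverseSquarePotential μ w)) := by
  have hr : ∀ᶠ r : ℝ in 𝓝[<] 1, 0 ≤ r ∧ r < 1 := by
    filter_upwards [Ioo_mem_nhdsLT (show (0 : ℝ) < 1 by norm_num)] with r hr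
    exact ⟨hr.1.le, hr.2⟩
  have hnorm : ∀ r : ℝ, 0 ≤ r → ‖(r : ℂ) * w‖ = r := fun r h0 => by
    rw [norm_mul, hw, Complex.norm_real, Real.norm_of_nonneg h0, mul_one]
  have hP : Tendsto (fun r : ℝ => poissonIntegral μ (r * w)) (𝓝[<] 1) (𝓝 0) := by
    have hb : Tendsto (fun r : ℝ => (1 - r ^ 2) * (4 * inverseSquarePotential μ w)) (𝓝[<] 1)
        (𝓝 0) := by
      have : Continuous fun r : ℝ => (1 - r ^ 2) * (4 * inverseSquarePotential μ w) := by fun_prop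
      simpa using (this.tendsto 1).mono_left nhdsWithin_le_nhds
    refine squeeze_zero' ?_ ?_ hb
    · filter_upwards [hr] with r hr
      rw [poissonIntegral_eq_mul, hnorm r hr.1]
      refine mul_nonneg ?_ (inverseSquarePotential_nonneg _ _)
      nlinarith
    · filter_upwards [hr] with r hr
      rw [poissonIntegral_eq_mul, hnorm r hr.1]
      have : 0 ≤ 1 - r ^ 2 := by nlinarith
      gcongr
      exact inverseSquarePotential_radial_le hE hEc hμ hw hwE hr.1 hr.2
  obtain ⟨δ, hδ, hd⟩ := exists_pos_le_norm_sub hE hwE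
  have hI : Tendsto (fun r : ℝ => ∫ ζ, 2 * ζ / (ζ - r * w) ^ 2 ∂μ) (𝓝[<] 1)
      (𝓝 (∫ ζ, 2 * ζ / (ζ - w) ^ 2 ∂μ)) := by
    refine tendsto_integral_filter_of_dominated_convergence (fun _ => 2 / (δ / 2) ^ 2) ?_ ?_
      (integrable_const _) ?_
    · exact .of_forall fun x => Measurable.aestronglyMeasurable (by fun_prop)
    · filter_upwards [hr] with r hr
      filter_upwards [ae_mem_of_measure_compl hμ] with ζ hζ
      have h1 : ‖ζ‖ = 1 := by simpa using hEc hζ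
      have h2 := norm_sub_le_two_mul_norm_sub_smul h1 hw hr.1 hr.2
      have h3 : δ / 2 ≤ ‖ζ - r * w‖ := by linarith [hd ζ hζ]
      rw [norm_div, norm_mul, norm_pow, h1, mul_one, Complex.norm_ofNat]
      gcongr
    · filter_upwards [ae_mem_of_measure_compl hμ] with ζ hζ
      have h3 : ζ - w ≠ 0 := norm_pos_iff.1 (by linarith [hd ζ hζ])
      have : ContinuousAt (fun r : ℝ => 2 * ζ / (ζ - r * w) ^ 2) 1 :=
        ContinuousAt.div (by fun_prop) (by fun_prop) (by simpa using h3)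
      simpa using this.tendsto.mono_left nhdsWithin_le_nhds
  have hI' : ‖∫ ζ, 2 * ζ / (ζ - w) ^ 2 ∂μ‖ = 2 * inverseSquarePotential μ w := by
    have : ∫ ζ, 2 * ζ / (ζ - w) ^ 2 ∂μ = -2 * w⁻¹ * (inverseSquarePotential μ w : ℂ) := by
      rw [inverseSquarePotential, ← integral_complex_ofReal, ← integral_const_mul]
      refine integral_congr_ae ?_
      filter_upwards [ae_mem_of_measure_compl hμ] with ζ hζ
      exact two_mul_div_sub_sq (by simpa using hEc hζ) hw
    rw [this, norm_mul, norm_mul, norm_inv, hw, norm_neg, Complex.norm_ofNat, inv_one, mul_one,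
      Complex.norm_real, Real.norm_of_nonneg (inverseSquarePotential_nonneg _ _)]
  have hS := (hP.neg.rexp).mul hI.norm
  rw [neg_zero, Real.exp_zero, one_mul, hI'] at hS
  refine hS.congr' ?_
  filter_upwards [hr] with r hr
  have hrE : (r : ℂ) * w ∉ E := notMem_of_norm_lt_one hEc (by rw [hnorm r hr.1]; exact hr.2)
  rw [deriv_singularInner hE hEc hμ hrE, norm_mul, norm_neg, norm_singularInner hE hEc hμ hrE]

end

/-! ### The Hardy norm as an integral over the circle -/

theorem measurable_inverseSquarePotential (μ : Measure ℂ) [SFinite μ] :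
    Measurable (inverseSquarePotential μ) := by
  have : StronglyMeasurable (Function.uncurry fun w ζ : ℂ => 1 / ‖ζ - w‖ ^ 2) := by
    apply Measurable.stronglyMeasurable
    unfold Function.uncurry
    fun_prop
  exact this.integral_prod_right.measurable

/-- The function `θ ↦ P(e^{iθ})^p` on the line, where `P` is the inverse square potential of `μ`.
Off the support of `μ`, `2 P` is the modulus of the boundary values of the derivative of the
singular inner function. -/
noncomputable def boundaryPower (μ : Measure ℂ) (p θ : ℝ) : ENNReal :=
  ENNReal.ofReal (inverseSquarePotential μ (Complex.exp (θ * Complex.I)) ^ p)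

theorem measurable_boundaryPower (μ : Measure ℂ) [SFinite μ] (p : ℝ) :
    Measurable (boundaryPower μ p) := by
  have h := (measurable_inverseSquarePotential μ).comp
    (show Measurable fun θ : ℝ => Complex.exp (θ * Complex.I) by fun_prop)
  exact (h.pow_const p).ennreal_ofReal

theorem ae_exp_notMem_of_circleLength_eq_zero {E : Set ℂ} (hE : IsClosed E)
    (h0 : circleLength E = 0) :
    ∀ᵐ θ : ℝ ∂volume.restrict (Ioc 0 (2 * π)), Complex.exp (θ * Complex.I) ∉ E := by
  rw [circleLength, Measure.smul_apply, smul_eq_mul, mul_eq_zero,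
    Measure.map_apply (by fun_prop) hE.measurableSet] at h0
  rw [ae_iff]
  simp only [not_not]
  refine h0.resolve_left ?_
  rw [ENNReal.ofReal_eq_zero, not_le]
  positivity

section

variable {μ : Measure ℂ} [IsFiniteMeasure μ] {E : Set ℂ} {p : ℝ}

/-- The boundary values control the `H^p` means: the upper bound is domination along radii, the
lower bound is Fatou's lemma. -/
theorem memHardy_deriv_singularInner_iff (hp : 0 < p) (hE : IsClosed E)
    (hEc : E ⊆ Metric.sphere 0 1) (h0 : circleLength E = 0) (hμ : μ Eᶜ = 0) :
    MemHardy p (deriv (singularInner μ)) ↔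
      ∫⁻ θ in Ioc 0 (2 * π), boundaryPower μ p θ ≠ ⊤ := by
  have hdiff := differentiableOn_deriv_singularInner hE hEc hμ
  have hae := ae_exp_notMem_of_circleLength_eq_zero hE h0
  have hpi : (0 : ℝ) ≤ 2 * π := by positivity
  have hexp (θ : ℝ) : ‖Complex.exp (θ * Complex.I)‖ = 1 := Complex.norm_exp_ofReal_mul_I θ
  have havg (r : ℝ) : circleAverage (fun z => ‖deriv (singularInner μ) z‖ ^ p) 0 r =
      (2 * π)⁻¹ * ∫ θ in Ioc 0 (2 * π),
        ‖deriv (singularInner μ) (r * Complex.exp (θ * Complex.I))‖ ^ p := by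
    rw [circleAverage_def, intervalIntegral.integral_of_le hpi, smul_eq_mul]
    simp only [circleMap_zero]
  constructor
  · rintro ⟨-, C, hC⟩
    have hint : ∀ r : ℝ, 0 ≤ r → r < 1 → Integrable (fun θ : ℝ =>
        ‖deriv (singularInner μ) (r * Complex.exp (θ * Complex.I))‖ ^ p)
        (volume.restrict (Ioc 0 (2 * π))) := by
      intro r hr0 hr1
      have hc : Continuous fun θ : ℝ =>
          deriv (singularInner μ) (r * Complex.exp (θ * Complex.I)) := by
        refine hdiff.continuousOn.comp_continuous (by fun_prop) fun θ => ?_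
        rw [mem_ball_zero_iff, norm_mul, hexp, mul_one, Complex.norm_real,
          Real.norm_of_nonneg hr0]
        exact hr1
      exact (hc.norm.rpow_const fun _ => Or.inr hp.le).integrableOn_Ioc
    obtain ⟨u, -, hu1, hu⟩ := exists_seq_strictMono_tendsto' (show (0 : ℝ) < 1 by norm_num)
    have hu' : Tendsto u atTop (𝓝[<] 1) :=
      tendsto_nhdsWithin_iff.2 ⟨hu, .of_forall fun n => (hu1 n).2⟩
    have hbound (n : ℕ) : ∫⁻ θ in Ioc 0 (2 * π), ENNReal.ofReal
        (‖deriv (singularInner μ) (u n * Complex.exp (θ * Complex.I))‖ ^ p) ≤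
          ENNReal.ofReal (2 * π * C) := by
      rw [← ofReal_integral_eq_lintegral_ofReal (hint _ (hu1 n).1.le (hu1 n).2)
        (.of_forall fun θ => by positivity)]
      refine ENNReal.ofReal_le_ofReal ?_
      have := hC _ (hu1 n).1.le (hu1 n).2
      rwa [havg, inv_mul_le_iff₀ (by positivity)] at this
    have hlim : ∫⁻ θ in Ioc 0 (2 * π), boundaryPower μ p θ ≤
        ∫⁻ θ in Ioc 0 (2 * π), liminf (fun n => ENNReal.ofReal
          (‖deriv (singularInner μ) (u n * Complex.exp (θ * Complex.I))‖ ^ p)) atTop := by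
      refine lintegral_mono_ae ?_
      filter_upwards [hae] with θ hθ
      have ht := ((tendsto_norm_deriv_singularInner hE hEc hμ (hexp θ) hθ).comp hu').rpow_const
        (p := p) (Or.inr hp.le)
      have ht' := ENNReal.tendsto_ofReal ht
      rw [boundaryPower]
      refine le_trans (ENNReal.ofReal_le_ofReal ?_) ht'.liminf_eq.ge
      have hP := inverseSquarePotential_nonneg μ (Complex.exp (θ * Complex.I))
      exact Real.rpow_le_rpow hP (by linarith) hp.le
    refine ne_top_of_le_ne_top (ENNReal.ofReal_ne_top (r := 2 * π * C))
      (hlim.trans ((lintegral_liminf_le' ?_).trans (liminf_le_of_le (by isBoundedDefault) fun b hb => ?_)))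
    · exact fun n =>
        (hint _ (hu1 n).1.le (hu1 n).2).aestronglyMeasurable.aemeasurable.ennreal_ofReal
    · obtain ⟨n, hn⟩ := hb.exists
      exact hn.trans (hbound n)
  · intro hfin
    have hintP : Integrable (fun θ : ℝ =>
        8 ^ p * inverseSquarePotential μ (Complex.exp (θ * Complex.I)) ^ p)
        (volume.restrict (Ioc 0 (2 * π))) := by
      refine Integrable.const_mul ?_ _
      refine (lintegral_ofReal_ne_top_iff_integrable ?_ ?_).1 hfin
      · exact (((measurable_inverseSquarePotential μ).comp
          (show Measurable fun θ : ℝ => Complex.exp (θ * Complex.I) by fun_prop)).pow_const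
            p).aestronglyMeasurable
      · exact .of_forall fun θ => Real.rpow_nonneg (inverseSquarePotential_nonneg _ _) _
    refine ⟨hdiff, (2 * π)⁻¹ * ∫ θ in Ioc 0 (2 * π),
      8 ^ p * inverseSquarePotential μ (Complex.exp (θ * Complex.I)) ^ p, fun r hr0 hr1 => ?_⟩
    rw [havg]
    refine mul_le_mul_of_nonneg_left ?_ (by positivity)
    refine integral_mono_of_nonneg (.of_forall fun θ => by positivity) hintP ?_
    filter_upwards [hae] with θ hθ
    have hP := inverseSquarePotential_nonneg μ (Complex.exp (θ * Complex.I))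
    rw [← Real.mul_rpow (by norm_num) hP]
    refine Real.rpow_le_rpow (norm_nonneg _) ?_ hp.le
    have h1 := norm_deriv_singularInner_le hE hEc hμ (z := r * Complex.exp (θ * Complex.I)) (by
      rw [norm_mul, hexp, mul_one, Complex.norm_real, Real.norm_of_nonneg hr0]; exact hr1)
    have h2 := inverseSquarePotential_radial_le hE hEc hμ (hexp θ) hθ hr0 hr1
    linarith

end

/-! ### Chords of the circle -/

theorem norm_exp_sub_exp (x y : ℝ) :
    ‖Complex.exp (x * Complex.I) - Complex.exp (y * Complex.I)‖ =
      2 * |Real.sin ((x - y) / 2)| := by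
  have h : Complex.exp (x * Complex.I) - Complex.exp (y * Complex.I) =
      Complex.exp (y * Complex.I) * (Complex.exp (Complex.I * (x - y : ℝ)) - 1) := by
    rw [mul_sub, ← Complex.exp_add, mul_one]
    congr 2
    push_cast
    ring
  rw [h, norm_mul, Complex.norm_exp_ofReal_mul_I, one_mul, Complex.norm_exp_I_mul_ofReal_sub_one,
    norm_mul, Real.norm_eq_abs, Real.norm_eq_abs, abs_two]

theorem norm_exp_sub_exp_le (x y : ℝ) :
    ‖Complex.exp (x * Complex.I) - Complex.exp (y * Complex.I)‖ ≤ |x - y| := by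
  have h : |Real.sin ((x - y) / 2)| ≤ |(x - y) / 2| := Real.abs_sin_le_abs
  rw [abs_div, abs_two] at h
  rw [norm_exp_sub_exp]
  linarith

theorem exp_add_two_pi_mul_I (x : ℝ) :
    Complex.exp ((x + 2 * π : ℝ) * Complex.I) = Complex.exp (x * Complex.I) := by
  push_cast
  rw [add_mul, Complex.exp_periodic]

theorem exp_add_int_mul_two_pi_mul_I (x : ℝ) (n : ℤ) :
    Complex.exp ((x + n * (2 * π) : ℝ) * Complex.I) = Complex.exp (x * Complex.I) := by
  rw [Complex.exp_eq_exp_iff_exists_int]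
  exact ⟨n, by push_cast; ring⟩

theorem two_div_pi_mul_min_le_sin {x : ℝ} (h0 : 0 ≤ x) (h1 : x ≤ π) :
    2 / π * min x (π - x) ≤ Real.sin x := by
  have hpi : 0 ≤ 2 / π := by positivity
  rcases le_total x (π / 2) with h | h
  · exact (mul_le_mul_of_nonneg_left (min_le_left _ _) hpi).trans (Real.mul_le_sin h0 h)
  · rw [← Real.sin_pi_sub]
    exact (mul_le_mul_of_nonneg_left (min_le_right _ _) hpi).trans
      (Real.mul_le_sin (by linarith) (by linarith))

/-- Every point of the circle has an argument in a given half-open interval of length `2π`. -/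
theorem exists_exp_eq_of_norm_eq_one {ζ : ℂ} (hζ : ‖ζ‖ = 1) (a : ℝ) :
    ∃ φ : ℝ, a < φ ∧ φ ≤ a + 2 * π ∧ Complex.exp (φ * Complex.I) = ζ := by
  have hm := toIocMod_mem_Ioc Real.two_pi_pos a ζ.arg
  refine ⟨toIocMod Real.two_pi_pos a ζ.arg, hm.1, hm.2, ?_⟩
  have h : toIocMod Real.two_pi_pos a ζ.arg =
      ζ.arg + (-toIocDiv Real.two_pi_pos a ζ.arg : ℤ) * (2 * π) := by
    rw [toIocMod, zsmul_eq_mul]; push_cast; ring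
  rw [h, exp_add_int_mul_two_pi_mul_I]
  have := Complex.norm_mul_exp_arg_mul_I ζ
  rwa [hζ, Complex.ofReal_one, one_mul] at this

/-! ### The geometry of a complementary arc -/

section

variable {E : Set ℂ} {J : ℝ × ℝ}

/-- The point `e^{i(a + 2π)} = e^{ia}` lies in `E`, hence not in the arc. -/
theorem snd_le_fst_add_two_pi (hJ : J ∈ complementaryArcs E) : J.2 ≤ J.1 + 2 * π := by
  obtain ⟨-, -, -, ha, -, hno⟩ := hJ
  by_contra! h
  exact hno _ ⟨by linarith [Real.two_pi_pos], h⟩ (by rwa [exp_add_two_pi_mul_I])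

theorem two_pi_mul_arcLength (J : ℝ × ℝ) : 2 * π * arcLength J = J.2 - J.1 := by
  rw [arcLength]; field_simp

theorem arcLength_pos (hJ : J ∈ complementaryArcs E) : 0 < arcLength J :=
  div_pos (sub_pos.2 hJ.2.2.1) Real.two_pi_pos

theorem arcLength_le_one (hJ : J ∈ complementaryArcs E) : arcLength J ≤ 1 := by
  rw [arcLength, div_le_one Real.two_pi_pos]
  linarith [snd_le_fst_add_two_pi hJ]

theorem norm_arcPoint (hJ : J ∈ complementaryArcs E) : ‖arcPoint J‖ = 1 - arcLength J / 2 := by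
  rw [arcPoint, norm_mul, Complex.norm_exp_ofReal_mul_I, mul_one, Complex.norm_real,
    Real.norm_of_nonneg]
  linarith [arcLength_le_one hJ]

/-- The distance from a point of a complementary arc to `E` is comparable to the angular distance
to the nearer endpoint. -/
theorem min_le_norm_sub_exp (hEc : E ⊆ Metric.sphere 0 1) (hJ : J ∈ complementaryArcs E)
    {θ : ℝ} (hθ : θ ∈ Ioo J.1 J.2) {ζ : ℂ} (hζ : ζ ∈ E) :
    2 / π * min (θ - J.1) (J.2 - θ) ≤ ‖ζ - Complex.exp (θ * Complex.I)‖ := by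
  obtain ⟨φ, h1, h2, rfl⟩ := exists_exp_eq_of_norm_eq_one (by simpa using hEc hζ) J.1
  have h3 : J.2 ≤ φ := by
    by_contra! h
    exact hJ.2.2.2.2.2 φ ⟨h1, h⟩ hζ
  have h4 := two_div_pi_mul_min_le_sin (x := (φ - θ) / 2) (by linarith [hθ.2])
    (by linarith [hθ.1])
  rw [norm_exp_sub_exp]
  have h5 := le_abs_self (Real.sin ((φ - θ) / 2))
  have h6 : min (θ - J.1) (J.2 - θ) ≤ 2 * min ((φ - θ) / 2) (π - (φ - θ) / 2) := by
    rw [mul_min_of_nonneg _ _ zero_le_two]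
    refine le_min ((min_le_right _ _).trans (by linarith)) ((min_le_left _ _).trans (by linarith))
  have h7 : 2 / π * min (θ - J.1) (J.2 - θ) ≤
      2 / π * (2 * min ((φ - θ) / 2) (π - (φ - θ) / 2)) :=
    mul_le_mul_of_nonneg_left h6 (by positivity)
  linarith

theorem norm_arcPoint_sub_exp_le (hJ : J ∈ complementaryArcs E)
    {θ : ℝ} (hθ : θ ∈ Ioo J.1 J.2) :
    ‖arcPoint J - Complex.exp (θ * Complex.I)‖ ≤ 4 * arcLength J := by
  have hl := arcLength_pos hJ
  have h1 := norm_exp_sub_exp_le ((J.1 + J.2) / 2) θ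
  have h2 : |(J.1 + J.2) / 2 - θ| ≤ π * arcLength J := by
    rw [abs_le]
    constructor <;> linarith [two_pi_mul_arcLength J, hθ.1, hθ.2]
  have h3 : arcPoint J - Complex.exp (θ * Complex.I) =
      (Complex.exp (((J.1 + J.2) / 2 : ℝ) * Complex.I) - Complex.exp (θ * Complex.I)) -
        ((arcLength J / 2 : ℝ) : ℂ) * Complex.exp (((J.1 + J.2) / 2 : ℝ) * Complex.I) := by
    rw [arcPoint]; push_cast; ring
  rw [h3]
  refine (norm_sub_le _ _).trans ?_
  rw [norm_mul, Complex.norm_exp_ofReal_mul_I, mul_one, Complex.norm_real,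
    Real.norm_of_nonneg (by positivity)]
  have h4 : π * arcLength J ≤ 3.15 * arcLength J := by gcongr; exact Real.pi_lt_d2.le
  linarith

theorem half_arcLength_le_norm_sub_arcPoint (hEc : E ⊆ Metric.sphere 0 1)
    (hJ : J ∈ complementaryArcs E) {ζ : ℂ} (hζ : ζ ∈ E) :
    arcLength J / 2 ≤ ‖ζ - arcPoint J‖ := by
  have h := norm_sub_norm_le ζ (arcPoint J)
  have h1 : ‖ζ‖ = 1 := by simpa using hEc hζ
  rw [h1, norm_arcPoint hJ] at h
  linarith

theorem arcPoint_notMem (hEc : E ⊆ Metric.sphere 0 1) (hJ : J ∈ complementaryArcs E) :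
    arcPoint J ∉ E :=
  notMem_of_norm_lt_one hEc (by rw [norm_arcPoint hJ]; linarith [arcLength_pos hJ])

/-! ### The integral over a complementary arc -/

variable {μ : Measure ℂ} [IsFiniteMeasure μ] {p : ℝ}

/-- On the arc `J` the potential is at least a multiple of its value at `z_J`, because the points
of the arc are within `4 |J|` of `z_J`, while `E` is at distance at least `|J| / 2` from it. -/
theorem inverseSquarePotential_arcPoint_le (hE : IsClosed E) (hEc : E ⊆ Metric.sphere 0 1)
    (hμ : μ Eᶜ = 0) (hJ : J ∈ complementaryArcs E) {θ : ℝ} (hθ : θ ∈ Ioo J.1 J.2) :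
    inverseSquarePotential μ (arcPoint J) ≤
      81 * inverseSquarePotential μ (Complex.exp (θ * Complex.I)) := by
  have := inverseSquarePotential_le_of_norm_sub_le (μ := μ) hE hμ (w' := arcPoint J) (c := 9)
    (hJ.2.2.2.2.2 θ hθ) fun ζ hζ => by
      have h1 := norm_sub_le_norm_sub_add_norm_sub ζ (arcPoint J) (Complex.exp (θ * Complex.I))
      have h2 := half_arcLength_le_norm_sub_arcPoint hEc hJ hζ
      have h3 := norm_arcPoint_sub_exp_le hJ hθ
      linarith
  linarith

/-- Towards the endpoints of the arc `J`, which belong to `E`, the potential grows at most like the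
inverse square of the distance to the nearer one. -/
theorem inverseSquarePotential_exp_le (hE : IsClosed E) (hEc : E ⊆ Metric.sphere 0 1)
    (hμ : μ Eᶜ = 0) (hJ : J ∈ complementaryArcs E) {θ : ℝ} (hθ : θ ∈ Ioo J.1 J.2) :
    inverseSquarePotential μ (Complex.exp (θ * Complex.I)) ≤
      (10 * arcLength J / min (θ - J.1) (J.2 - θ)) ^ 2 *
        inverseSquarePotential μ (arcPoint J) := by
  refine inverseSquarePotential_le_of_norm_sub_le hE hμ (arcPoint_notMem hEc hJ) fun ζ hζ => ?_
  set w := Complex.exp (θ * Complex.I)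
  set d := min (θ - J.1) (J.2 - θ)
  have hl := arcLength_pos hJ
  have hd : 0 < d := lt_min (by linarith [hθ.1]) (by linarith [hθ.2])
  have h1 := norm_sub_le_norm_sub_add_norm_sub ζ w (arcPoint J)
  have h2 : 2 / π * d ≤ ‖ζ - w‖ := min_le_norm_sub_exp hEc hJ hθ hζ
  have h3 : ‖w - arcPoint J‖ ≤ 4 * arcLength J := by
    rw [norm_sub_rev]; exact norm_arcPoint_sub_exp_le hJ hθ
  -- The nearer endpoint is at most half the angular length `2π |J|` away.
  have h4 : d ≤ π * arcLength J := by
    have h5 : d ≤ θ - J.1 := min_le_left _ _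
    have h6 : d ≤ J.2 - θ := min_le_right _ _
    linarith [two_pi_mul_arcLength J]
  have h5 : 2 * d ≤ π * ‖ζ - w‖ := by
    rw [div_mul_eq_mul_div, div_le_iff₀ Real.pi_pos] at h2
    linarith
  have h6 : π * arcLength J ≤ 3.15 * arcLength J := by gcongr; exact Real.pi_lt_d2.le
  have h7 : π * ‖ζ - w‖ ≤ 3.15 * ‖ζ - w‖ := by gcongr; exact Real.pi_lt_d2.le
  rw [div_mul_eq_mul_div, le_div_iff₀ hd]
  have h8 : d * ‖ζ - w‖ ≤ 3.15 * arcLength J * ‖ζ - w‖ := by gcongr; linarith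
  have h9 : arcLength J * (2 * d) ≤ arcLength J * (3.15 * ‖ζ - w‖) :=
    mul_le_mul_of_nonneg_left (by linarith) hl.le
  have h10 : ‖ζ - arcPoint J‖ * d ≤ (‖ζ - w‖ + 4 * arcLength J) * d := by gcongr; linarith
  nlinarith [mul_nonneg hl.le (norm_nonneg (ζ - w))]

/-- The singularities of `d ^ (-2p)`, with `d` the distance to the endpoints of an interval, are
integrable precisely because `p < 1 / 2`. -/
theorem lintegral_rpow_add_rpow (hp' : p < 1 / 2) {a b : ℝ} (hab : a < b) :
    ∫⁻ θ in Ioo a b, ENNReal.ofReal ((θ - a) ^ (-(2 * p)) + (b - θ) ^ (-(2 * p))) =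
      ENNReal.ofReal (2 * (b - a) ^ (1 - 2 * p) / (1 - 2 * p)) := by
  have h1 : -1 < -(2 * p) := by linarith
  have hi : IntervalIntegrable (fun x : ℝ => x ^ (-(2 * p))) volume 0 (b - a) :=
    intervalIntegral.intervalIntegrable_rpow' h1
  have hi1 : IntervalIntegrable (fun θ : ℝ => (θ - a) ^ (-(2 * p))) volume a b := by
    simpa using hi.comp_sub_right a
  have hi2 : IntervalIntegrable (fun θ : ℝ => (b - θ) ^ (-(2 * p))) volume a b := by
    have := (hi.comp_sub_left b).symm
    simpa using this
  have hv : ∫ x in (0)..(b - a), x ^ (-(2 * p)) = (b - a) ^ (1 - 2 * p) / (1 - 2 * p) := by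
    rw [integral_rpow (Or.inl h1), Real.zero_rpow (by linarith), sub_zero,
      neg_add_eq_sub]
  have hs := intervalIntegral.integral_add hi1 hi2
  rw [intervalIntegral.integral_comp_sub_right (fun x => x ^ (-(2 * p))),
    intervalIntegral.integral_comp_sub_left (fun x => x ^ (-(2 * p))), sub_self, sub_self, hv,
    intervalIntegral.integral_of_le hab.le, integral_Ioc_eq_integral_Ioo] at hs
  have hI : IntegrableOn (fun θ => (θ - a) ^ (-(2 * p)) + (b - θ) ^ (-(2 * p))) (Ioo a b) :=
    ((intervalIntegrable_iff_integrableOn_Ioo_of_le hab.le).1 (hi1.add hi2))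
  rw [← ofReal_integral_eq_lintegral_ofReal hI, hs]
  · congr 1; ring
  · filter_upwards [ae_restrict_mem measurableSet_Ioo] with θ hθ
    have h2 : 0 ≤ θ - a := by linarith [hθ.1]
    have h3 : 0 ≤ b - θ := by linarith [hθ.2]
    exact add_nonneg (Real.rpow_nonneg h2 _) (Real.rpow_nonneg h3 _)

/-- The term of the arc `J` is dominated by the integral over `J`. -/
theorem ofReal_arcTerm_le (hp : 0 < p) (hE : IsClosed E) (hEc : E ⊆ Metric.sphere 0 1)
    (hμ : μ Eᶜ = 0) (hJ : J ∈ complementaryArcs E) :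
    ENNReal.ofReal (poissonIntegral μ (arcPoint J) ^ p * arcLength J ^ (1 - p)) ≤
      ENNReal.ofReal (81 ^ p) * ∫⁻ θ in Ioo J.1 J.2, boundaryPower μ p θ := by
  have hl := arcLength_pos hJ
  have hl1 := arcLength_le_one hJ
  set W := inverseSquarePotential μ (arcPoint J)
  have hW : 0 ≤ W := inverseSquarePotential_nonneg _ _
  have h1 : poissonIntegral μ (arcPoint J) ≤ arcLength J * W := by
    rw [poissonIntegral_eq_mul, norm_arcPoint hJ]
    gcongr
    nlinarith
  have h0 : 0 ≤ poissonIntegral μ (arcPoint J) := by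
    rw [poissonIntegral_eq_mul, norm_arcPoint hJ]
    exact mul_nonneg (by nlinarith) hW
  have h2 : poissonIntegral μ (arcPoint J) ^ p * arcLength J ^ (1 - p) ≤
      W ^ p * (J.2 - J.1) := by
    calc _ ≤ (arcLength J * W) ^ p * arcLength J ^ (1 - p) := by gcongr
      _ = W ^ p * (arcLength J ^ p * arcLength J ^ (1 - p)) := by
        rw [Real.mul_rpow hl.le hW]; ring
      _ = W ^ p * arcLength J := by
        rw [← Real.rpow_add hl, add_sub_cancel, Real.rpow_one]
      _ ≤ _ := by
        have : 1 * arcLength J ≤ 2 * π * arcLength J := by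
          gcongr; linarith [Real.pi_gt_three]
        gcongr
        linarith [two_pi_mul_arcLength J]
  calc _ ≤ ENNReal.ofReal (W ^ p * (J.2 - J.1)) := ENNReal.ofReal_le_ofReal h2
    _ = ∫⁻ θ in Ioo J.1 J.2, ENNReal.ofReal (W ^ p) := by
      rw [setLIntegral_const, Real.volume_Ioo, ENNReal.ofReal_mul (by positivity)]
    _ ≤ ∫⁻ θ in Ioo J.1 J.2, ENNReal.ofReal (81 ^ p) * boundaryPower μ p θ := by
      refine setLIntegral_mono' measurableSet_Ioo fun θ hθ => ?_
      have hP := inverseSquarePotential_nonneg μ (Complex.exp (θ * Complex.I))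
      rw [boundaryPower, ← ENNReal.ofReal_mul (by positivity), ← Real.mul_rpow (by norm_num) hP]
      refine ENNReal.ofReal_le_ofReal (Real.rpow_le_rpow hW ?_ hp.le)
      exact inverseSquarePotential_arcPoint_le hE hEc hμ hJ hθ
    _ = _ := lintegral_const_mul _ (measurable_boundaryPower μ p)

/-- The integral over the arc `J` is dominated by its term, with a constant independent of `J`. -/
theorem lintegral_arc_boundaryPower_le (hp : 0 < p) (hp' : p < 1 / 2) (hE : IsClosed E)
    (hEc : E ⊆ Metric.sphere 0 1) (hμ : μ Eᶜ = 0) (hJ : J ∈ complementaryArcs E) :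
    ∫⁻ θ in Ioo J.1 J.2, boundaryPower μ p θ ≤
      ENNReal.ofReal (2 ^ p * 10 ^ (2 * p) * (2 * (2 * π) ^ (1 - 2 * p) / (1 - 2 * p))) *
        ENNReal.ofReal (poissonIntegral μ (arcPoint J) ^ p * arcLength J ^ (1 - p)) := by
  have hl := arcLength_pos hJ
  have hl1 := arcLength_le_one hJ
  have hq : 0 < 1 - 2 * p := by linarith
  set W := inverseSquarePotential μ (arcPoint J)
  have hW : 0 ≤ W := inverseSquarePotential_nonneg _ _
  have h1 : arcLength J * W ≤ 2 * poissonIntegral μ (arcPoint J) := by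
    rw [poissonIntegral_eq_mul, norm_arcPoint hJ, ← mul_assoc]
    gcongr
    nlinarith
  have h0 : 0 ≤ poissonIntegral μ (arcPoint J) := by
    have := mul_nonneg hl.le hW
    linarith
  have h2 : W ^ p * arcLength J ≤
      2 ^ p * (poissonIntegral μ (arcPoint J) ^ p * arcLength J ^ (1 - p)) := by
    calc W ^ p * arcLength J = W ^ p * (arcLength J ^ p * arcLength J ^ (1 - p)) := by
          rw [← Real.rpow_add hl, add_sub_cancel, Real.rpow_one]
      _ = (arcLength J * W) ^ p * arcLength J ^ (1 - p) := by
        rw [Real.mul_rpow hl.le hW]; ring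
      _ ≤ (2 * poissonIntegral μ (arcPoint J)) ^ p * arcLength J ^ (1 - p) := by gcongr
      _ = _ := by rw [Real.mul_rpow (by norm_num) h0]; ring
  -- The coefficient of `d ^ (-2p)` in the pointwise bound, `d` the distance to the endpoints.
  set A := W ^ p * (10 * arcLength J) ^ (2 * p)
  have hA : 0 ≤ A := by positivity
  calc
    _ ≤ ∫⁻ θ in Ioo J.1 J.2, ENNReal.ofReal A *
        ENNReal.ofReal ((θ - J.1) ^ (-(2 * p)) + (J.2 - θ) ^ (-(2 * p))) := by
      refine setLIntegral_mono' measurableSet_Ioo fun θ hθ => ?_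
      have hθ1 : 0 < θ - J.1 := by linarith [hθ.1]
      have hθ2 : 0 < J.2 - θ := by linarith [hθ.2]
      have hd : 0 < min (θ - J.1) (J.2 - θ) := lt_min hθ1 hθ2
      have hP := inverseSquarePotential_nonneg μ (Complex.exp (θ * Complex.I))
      rw [boundaryPower, ← ENNReal.ofReal_mul hA]
      refine ENNReal.ofReal_le_ofReal ?_
      calc _ ≤ ((10 * arcLength J / min (θ - J.1) (J.2 - θ)) ^ 2 * W) ^ p :=
            Real.rpow_le_rpow hP (inverseSquarePotential_exp_le hE hEc hμ hJ hθ) hp.le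
        _ = A * min (θ - J.1) (J.2 - θ) ^ (-(2 * p)) := by
          rw [Real.mul_rpow (by positivity) hW, ← Real.rpow_natCast_mul (by positivity),
            Real.div_rpow (by positivity) hd.le, Real.rpow_neg hd.le]
          simp only [A]
          push_cast
          ring
        _ ≤ _ := by
          gcongr
          rcases min_choice (θ - J.1) (J.2 - θ) with h | h <;> rw [h]
          · linarith [Real.rpow_nonneg hθ2.le (-(2 * p))]
          · linarith [Real.rpow_nonneg hθ1.le (-(2 * p))]
    _ = ENNReal.ofReal (A * (2 * (J.2 - J.1) ^ (1 - 2 * p) / (1 - 2 * p))) := by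
      rw [lintegral_const_mul _ (by fun_prop), lintegral_rpow_add_rpow hp' hJ.2.2.1,
        ENNReal.ofReal_mul hA]
    _ ≤ _ := by
      rw [← ENNReal.ofReal_mul (by positivity)]
      refine ENNReal.ofReal_le_ofReal ?_
      have h3 : A * (2 * (J.2 - J.1) ^ (1 - 2 * p) / (1 - 2 * p)) =
          10 ^ (2 * p) * (2 * (2 * π) ^ (1 - 2 * p) / (1 - 2 * p)) * (W ^ p * arcLength J) := by
        have h4 : arcLength J ^ (2 * p) * arcLength J ^ (1 - 2 * p) = arcLength J := by
          rw [← Real.rpow_add hl, add_sub_cancel, Real.rpow_one]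
        simp only [A]
        rw [← two_pi_mul_arcLength, Real.mul_rpow (by norm_num) hl.le,
          Real.mul_rpow (by positivity) hl.le]
        nth_rw 3 [← h4]
        ring
      rw [h3]
      calc _ ≤ 10 ^ (2 * p) * (2 * (2 * π) ^ (1 - 2 * p) / (1 - 2 * p)) *
            (2 ^ p * (poissonIntegral μ (arcPoint J) ^ p * arcLength J ^ (1 - p))) := by gcongr
        _ = _ := by ring

end

/-! ### The complementary arcs as intervals of the line -/

theorem boundaryPower_add_two_pi (μ : Measure ℂ) (p θ : ℝ) :
    boundaryPower μ p (θ + 2 * π) = boundaryPower μ p θ := by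
  rw [boundaryPower, exp_add_two_pi_mul_I, boundaryPower]

theorem lintegral_boundaryPower_preimage_add (μ : Measure ℂ) (p : ℝ) (s : Set ℝ) :
    ∫⁻ θ in (fun x => x + 2 * π) ⁻¹' s, boundaryPower μ p θ = ∫⁻ θ in s, boundaryPower μ p θ := by
  have := (measurePreserving_add_right volume (2 * π)).setLIntegral_comp_preimage_emb
    (measurableEmbedding_addRight _) (boundaryPower μ p) s
  simpa only [boundaryPower_add_two_pi] using this

section

variable {E : Set ℂ}

/-- Distinct complementary arcs are disjoint as intervals of the line, not only modulo `2π`. -/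
theorem pairwise_disjoint_complementaryArcs (E : Set ℂ) :
    Pairwise (Function.onFun Disjoint fun J : complementaryArcs E => Ioo J.1.1 J.1.2) := by
  have key : ∀ J ∈ complementaryArcs E, ∀ K ∈ complementaryArcs E, ∀ θ, θ ∈ Ioo J.1 J.2 →
      θ ∈ Ioo K.1 K.2 → J.1 ≤ K.1 ∧ K.2 ≤ J.2 := by
    intro J hJ K hK θ h1 h2
    constructor
    · by_contra! h
      exact hK.2.2.2.2.2 J.1 ⟨h, h1.1.trans h2.2⟩ hJ.2.2.2.1
    · by_contra! h
      exact hK.2.2.2.2.2 J.2 ⟨h2.1.trans h1.2, h⟩ hJ.2.2.2.2.1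
  intro J K hne
  refine Set.disjoint_left.2 fun θ h1 h2 => hne ?_
  have a := key J.1 J.2 K.1 K.2 θ h1 h2
  have b := key K.1 K.2 J.1 J.2 θ h2 h1
  exact Subtype.ext (Prod.ext (le_antisymm a.1 b.1) (le_antisymm b.2 a.2))

theorem countable_complementaryArcs (E : Set ℂ) : Countable (complementaryArcs E) := by
  have := Set.PairwiseDisjoint.countable_of_isOpen (ι := complementaryArcs E) (a := univ)
    (s := fun J => Ioo J.1.1 J.1.2)
    (fun J _ K _ h => pairwise_disjoint_complementaryArcs E h) (fun _ _ => isOpen_Ioo)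
    (fun J _ => nonempty_Ioo.2 J.2.2.2.1)
  exact Set.countable_univ_iff.1 this

/-- Modulo `2π`, the complementary arcs cover the complement of `E`. -/
theorem exists_complementaryArc (hE : IsClosed E) (hEc : E ⊆ Metric.sphere 0 1)
    (hne : E.Nonempty) {θ : ℝ} (hθ : θ ∈ Ioc 0 (2 * π))
    (hθE : Complex.exp (θ * Complex.I) ∉ E) :
    ∃ J ∈ complementaryArcs E, θ ∈ Ioo J.1 J.2 ∨ θ + 2 * π ∈ Ioo J.1 J.2 := by
  set T : Set ℝ := (fun t : ℝ => Complex.exp (t * Complex.I)) ⁻¹' E with hT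
  have hTc : IsClosed T := hE.preimage (by fun_prop)
  obtain ⟨ζ, hζ⟩ := hne
  have hζ1 : ‖ζ‖ = 1 := by simpa using hEc hζ
  obtain ⟨s, hs1, hs2, hs⟩ := exists_exp_eq_of_norm_eq_one hζ1 (θ - 2 * π)
  obtain ⟨t, ht1, -, ht⟩ := exists_exp_eq_of_norm_eq_one hζ1 θ
  have hsT : s ∈ T ∩ Iic θ := ⟨by simpa [hT, hs] using hζ, by simpa using hs2⟩
  have htT : t ∈ T ∩ Ici θ := ⟨by simpa [hT, ht] using hζ, ht1.le⟩
  have hba : BddAbove (T ∩ Iic θ) := ⟨θ, fun x hx => hx.2⟩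
  have hbb : BddBelow (T ∩ Ici θ) := ⟨θ, fun x hx => hx.2⟩
  have ha := (hTc.inter isClosed_Iic).csSup_mem ⟨s, hsT⟩ hba
  have hb := (hTc.inter isClosed_Ici).csInf_mem ⟨t, htT⟩ hbb
  have hsa := le_csSup hba hsT
  have hsup : ∀ x ∈ T, x ≤ θ → x ≤ sSup (T ∩ Iic θ) := fun x hx h => le_csSup hba ⟨hx, h⟩
  have hinf : ∀ x ∈ T, θ ≤ x → sInf (T ∩ Ici θ) ≤ x := fun x hx h => csInf_le hbb ⟨hx, h⟩
  set a := sSup (T ∩ Iic θ)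
  set b := sInf (T ∩ Ici θ)
  have haθ : a < θ := lt_of_le_of_ne ha.2 fun h => hθE (h ▸ ha.1)
  have hθb : θ < b := lt_of_le_of_ne hb.2 fun h => hθE (h ▸ hb.1)
  have hno : ∀ x ∈ Ioo a b, x ∉ T := by
    intro x hx hxT
    rcases le_total x θ with h | h
    · exact absurd (hsup x hxT h) (not_le.2 hx.1)
    · exact absurd (hinf x hxT h) (not_le.2 hx.2)
  rcases le_or_gt 0 a with h0 | h0
  · exact ⟨(a, b), ⟨h0, haθ.trans_le hθ.2, haθ.trans hθb, ha.1, hb.1, hno⟩, Or.inl ⟨haθ, hθb⟩⟩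
  -- An initial endpoint below `0` is moved into `[0, 2π)` by one period.
  · refine ⟨(a + 2 * π, b + 2 * π), ⟨?_, ?_, ?_, ?_, ?_, ?_⟩, Or.inr ⟨?_, ?_⟩⟩
    · linarith [hθ.1]
    · linarith
    · linarith
    · rw [exp_add_two_pi_mul_I]; exact ha.1
    · rw [exp_add_two_pi_mul_I]; exact hb.1
    · intro x hx
      have := hno (x - 2 * π) ⟨by linarith [hx.1], by linarith [hx.2]⟩
      rw [hT, mem_preimage, ← exp_add_two_pi_mul_I, sub_add_cancel] at this
      exact this
    · linarith
    · linarith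

/-- The arcs are disjoint intervals inside `(0, 4π)`, that is, inside two periods. -/
theorem tsum_lintegral_arcs_le (E : Set ℂ) (μ : Measure ℂ) (p : ℝ) :
    ∑' J : complementaryArcs E, ∫⁻ θ in Ioo J.1.1 J.1.2, boundaryPower μ p θ ≤
      2 * ∫⁻ θ in Ioc 0 (2 * π), boundaryPower μ p θ := by
  have := countable_complementaryArcs E
  rw [← lintegral_iUnion (fun _ => measurableSet_Ioo) (pairwise_disjoint_complementaryArcs E)]
  have hsub : ⋃ J : complementaryArcs E, Ioo J.1.1 J.1.2 ⊆
      Ioc 0 (2 * π) ∪ Ioc (2 * π) (2 * π + 2 * π) := by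
    rw [Ioc_union_Ioc_eq_Ioc (by positivity) (by linarith [Real.two_pi_pos])]
    refine iUnion_subset fun J θ hθ => ⟨J.2.1.trans_lt hθ.1, ?_⟩
    linarith [hθ.2, snd_le_fst_add_two_pi J.2, J.2.2.1]
  refine (lintegral_mono_set hsub).trans ((lintegral_union_le _ _ _).trans_eq ?_)
  rw [← lintegral_boundaryPower_preimage_add μ p (Ioc (2 * π) _),
    preimage_add_const_Ioc, sub_self, add_sub_cancel_right, two_mul (lintegral _ _)]

/-- Up to a null set, a period is covered by the arcs and their translates by `-2π`. -/
theorem lintegral_boundaryPower_le (hE : IsClosed E) (hEc : E ⊆ Metric.sphere 0 1)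
    (hne : E.Nonempty) (h0 : circleLength E = 0) (μ : Measure ℂ) (p : ℝ) :
    ∫⁻ θ in Ioc 0 (2 * π), boundaryPower μ p θ ≤
      2 * ∑' J : complementaryArcs E, ∫⁻ θ in Ioo J.1.1 J.1.2, boundaryPower μ p θ := by
  have := countable_complementaryArcs E
  rw [← lintegral_iUnion (fun _ => measurableSet_Ioo) (pairwise_disjoint_complementaryArcs E)]
  set U := ⋃ J : complementaryArcs E, Ioo J.1.1 J.1.2
  have hae : Ioc 0 (2 * π) ≤ᵐ[volume] (U ∪ (fun x => x + 2 * π) ⁻¹' U : Set ℝ) := by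
    filter_upwards [(ae_restrict_iff' measurableSet_Ioc).1
      (ae_exp_notMem_of_circleLength_eq_zero hE h0)] with θ h hθ
    obtain ⟨J, hJ, h1 | h1⟩ := exists_complementaryArc hE hEc hne hθ (h hθ)
    · exact Or.inl (mem_iUnion.2 ⟨⟨J, hJ⟩, h1⟩)
    · exact Or.inr (mem_iUnion.2 ⟨⟨J, hJ⟩, h1⟩)
  refine (lintegral_mono_set' hae).trans ((lintegral_union_le _ _ _).trans_eq ?_)
  rw [lintegral_boundaryPower_preimage_add, two_mul]

end

/-! ### The criterion -/

theorem summable_iff_tsum_ofReal_ne_top {ι : Type*} {f : ι → ℝ} (hf : ∀ i, 0 ≤ f i) :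
    Summable f ↔ ∑' i, ENNReal.ofReal (f i) ≠ ⊤ := by
  refine ⟨fun h => h.tsum_ofReal_ne_top, fun h => ?_⟩
  simpa only [ENNReal.toReal_ofReal (hf _)] using ENNReal.summable_toReal h

theorem mainTheorem7 (p : ℝ) (hp : 0 < p) (hp' : p < 1 / 2)
    (E : Set ℂ) (hE : IsClosed E) (hE_circle : E ⊆ Metric.sphere 0 1) (hE_null : circleLength E = 0)
    (μ : Measure ℂ) [IsFiniteMeasure μ] (hμ : μ Eᶜ = 0) :
    MemHardy p (deriv (singularInner μ)) ↔
      Summable (fun J : complementaryArcs E =>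
        poissonIntegral μ (arcPoint J) ^ p * arcLength J ^ (1 - p)) := by
  rw [memHardy_deriv_singularInner_iff hp hE hE_circle hE_null hμ,
    summable_iff_tsum_ofReal_ne_top fun J => ?_]
  swap
  · have hl := arcLength_pos J.2
    have hl1 := arcLength_le_one J.2
    refine mul_nonneg (Real.rpow_nonneg ?_ _) (Real.rpow_nonneg hl.le _)
    rw [poissonIntegral_eq_mul, norm_arcPoint J.2]
    exact mul_nonneg (by nlinarith) (inverseSquarePotential_nonneg _ _)
  constructor
  · intro h
    have h1 := ENNReal.tsum_le_tsum fun J : complementaryArcs E =>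
      ofReal_arcTerm_le hp hE hE_circle hμ J.2
    rw [ENNReal.tsum_mul_left] at h1
    refine ne_top_of_le_ne_top ?_ h1
    refine ENNReal.mul_ne_top ENNReal.ofReal_ne_top ?_
    exact ne_top_of_le_ne_top (ENNReal.mul_ne_top ENNReal.ofNat_ne_top h)
      (tsum_lintegral_arcs_le E μ p)
  · intro h
    rcases E.eq_empty_or_nonempty with rfl | hne
    -- There are no arcs, but the measure vanishes and so does its potential.
    · have hμ0 : μ = 0 := by simpa using hμ
      simp [boundaryPower, inverseSquarePotential, hμ0, Real.zero_rpow hp.ne']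
    · refine ne_top_of_le_ne_top ?_ (lintegral_boundaryPower_le hE hE_circle hne hE_null μ p)
      refine ENNReal.mul_ne_top ENNReal.ofNat_ne_top ?_
      have h1 := ENNReal.tsum_le_tsum fun J : complementaryArcs E =>
        lintegral_arc_boundaryPower_le hp hp' hE hE_circle hμ J.2
      rw [ENNReal.tsum_mul_left] at h1
      exact ne_top_of_le_ne_top (ENNReal.mul_ne_top ENNReal.ofReal_ne_top h) h1
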